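/- There is a universal constant $C>0$ such that the following holds. Let $\delta\in(0,1]$, let $k,m$ be natural numbers with $k\geq 12/\delta^2$ and $m\geq 4$, let $T=(t_{ij})$ be an $m\times k$ matrix of reals, and let $y\in\mathbb{R}^k$ be a vector of Euclidean norm $1$. Then there is a coordinate projection $P:\mathbb{R}^k\to\mathbb{R}^k$ (that is, the orthogonal projection onto the span of $\{e_j\}_{j\in S}$ for some $S\subset\{1,\dots,k\}$, where $e_1,\dots,e_k$ is the standard basis) of rank at most $\delta k$ such that $$C^{-1}\delta^2\min_{1\leq \ell\leq m}|(Ty)_\ell|\;\leq\;\frac{\max_{i,j}|t_{ij}|}{\sqrt{k}}+a,$$ where $a$ is the $\lfloor m/4\rfloor$-th largest (counted with multiplicity) of the $m$ numbers $|(TPy)_1|,\dots,|(TPy)_m|$. -/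

import Mathlib

open scoped Matrix

noncomputable section

/-- The `k`-th largest element (`k = 1, 2, …`, counted with multiplicity) of the finite family
`(a i)_{i ∈ J}` of reals; it is `0` when `k` exceeds the number of elements of `J`. -/
def kthLargest {ι : Type*} (k : ℕ) (J : Finset ι) (a : ι → ℝ) : ℝ :=
  ((J.val.map a).sort (· ≥ ·)).getD (k - 1) 0

/-- `P` is a coordinate projection of `ℝ^ι`: it is the orthogonal projection onto the span of
the standard basis vectors `e_j`, `j ∈ S`, for some set `S` of coordinates. -/
def IsCoordinateProjection {ι : Type*} [Fintype ι]
    (P : EuclideanSpace ℝ ι →ₗ[ℝ] EuclideanSpace ℝ ι) : Prop :=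
  ∃ S : Set ι, ∀ x : EuclideanSpace ℝ ι,
    (∀ j ∈ S, P x j = x j) ∧ (∀ j ∉ S, P x j = 0)

end

/-! The projection is random. Let `A` collect the few coordinates where `y` is large. Cut all
coordinates into blocks of size at most `N ≈ 3/δ`, pick one slot uniformly in each block, keep the
picked coordinates outside `A`, and add all of `A` on a fair coin flip. For a fixed row, let `f
true` and `f false` be the conditional means of the resulting sum. Then `f true + (N - 1) * f false`
is the full entry of `Ty`, so the two means cannot both be small and the second moment is at least
of order `(b / N) ^ 2`.

Outside `A` each term is at most `M * s`. Unless the inequality is trivial, this is tiny against `b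
/ N`, so the fourth moment is nearly at most 3 times the squared second moment, as for a Gaussian.
Paley–Zygmund makes each row large with probability at least 1/4, and averaging over rows gives one
choice good for a quarter of them. -/

/-! ### Moments and Paley–Zygmund -/

open scoped BigOperators in
/-- Moments up to order four of a sum of independent centred variables, each uniform on a finite
family of values bounded by `c`. -/
theorem moments_sum_centred {κ : Type*} [Fintype κ] [Nonempty κ] (c : ℝ) (q : ℕ)
    (w : Fin q → κ → ℝ) (hw : ∀ i, 𝔼 r, w i r = 0) (hc : ∀ i r, |w i r| ≤ c) :
    ∃ v : ℝ, 0 ≤ v ∧ (𝔼 g : Fin q → κ, ∑ i, w i (g i)) = 0 ∧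
      (𝔼 g : Fin q → κ, (∑ i, w i (g i)) ^ 2) = v ∧
      |𝔼 g : Fin q → κ, (∑ i, w i (g i)) ^ 3| ≤ c * v ∧
      (𝔼 g : Fin q → κ, (∑ i, w i (g i)) ^ 4) ≤ 3 * v ^ 2 + c ^ 2 * v := by
  induction q with
  | zero => exact ⟨0, by simp⟩
  | succ q ih =>
    obtain ⟨v, hv, h1, h2, h3, h4⟩ := ih (fun i => w i.succ) (fun i => hw _) (fun i => hc _)
    set S : (Fin q → κ) → ℝ := fun g => ∑ i, w i.succ (g i) with hS
    have key : ∀ φ : ℝ → ℝ, (𝔼 g : Fin (q + 1) → κ, φ (∑ i, w i (g i))) =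
        𝔼 r, 𝔼 g, φ (w 0 r + S g) := by
      intro φ
      rw [← Fintype.expect_equiv (Fin.consEquiv fun _ : Fin (q + 1) => κ)
        (fun p => φ (w 0 p.1 + S p.2)) _ (fun p => by simp [hS, Fin.sum_univ_succ, Fin.consEquiv])]
      rw [← Finset.univ_product_univ, Finset.expect_product]
    set n : κ → ℝ := w 0 with hn
    have n1 : 𝔼 r, n r = 0 := hw 0
    have nc : ∀ r, |n r| ≤ c := hc 0
    have n2 : 0 ≤ 𝔼 r, n r ^ 2 := Finset.expect_nonneg fun r _ => sq_nonneg _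
    have n3 : |𝔼 r, n r ^ 3| ≤ c * 𝔼 r, n r ^ 2 := by
      refine (Finset.abs_expect_le _ _).trans ?_
      rw [Finset.mul_expect]
      refine Finset.expect_le_expect fun r _ => ?_
      rw [abs_pow, pow_succ, sq_abs, mul_comm]
      exact mul_le_mul_of_nonneg_right (nc r) (sq_nonneg _)
    have n4 : 𝔼 r, n r ^ 4 ≤ c ^ 2 * 𝔼 r, n r ^ 2 := by
      rw [Finset.mul_expect]
      refine Finset.expect_le_expect fun r _ => ?_
      have := mul_le_mul_of_nonneg_right (sq_le_sq' (abs_le.1 (nc r)).1 (abs_le.1 (nc r)).2)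
        (sq_nonneg (n r))
      calc n r ^ 4 = n r ^ 2 * n r ^ 2 := by ring
        _ ≤ _ := this
    have h1' : (𝔼 g, S g) = 0 := h1
    have h2' : (𝔼 g, S g ^ 2) = v := h2
    refine ⟨(𝔼 r, n r ^ 2) + v, by positivity, ?_, ?_, ?_, ?_⟩
    · rw [key (fun x => x)]
      simp [Finset.expect_add_distrib, h1', n1]
    · rw [key (fun x => x ^ 2)]
      simp only [add_sq, Finset.expect_add_distrib, ← Finset.mul_expect, ← Finset.expect_mul,
        h1', h2', n1, Fintype.expect_const]
      ring
    · rw [key (fun x => x ^ 3)]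
      have e : ∀ a b : ℝ, (a + b) ^ 3 = a ^ 3 + 3 * a ^ 2 * b + 3 * a * b ^ 2 + b ^ 3 := by
        intros; ring
      simp only [e, Finset.expect_add_distrib, ← Finset.mul_expect, ← Finset.expect_mul,
        h1', h2', n1, Fintype.expect_const]
      calc _ = |(𝔼 r, n r ^ 3) + 𝔼 g, S g ^ 3| := by congr 1; ring
        _ ≤ _ := (abs_add_le _ _).trans (by linarith)
    · rw [key (fun x => x ^ 4)]
      have e : ∀ a b : ℝ, (a + b) ^ 4 =
          a ^ 4 + 4 * a ^ 3 * b + 6 * a ^ 2 * b ^ 2 + 4 * a * b ^ 3 + b ^ 4 := by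
        intros; ring
      simp only [e, Finset.expect_add_distrib, ← Finset.mul_expect, ← Finset.expect_mul,
        h1', h2', n1, Fintype.expect_const]
      -- The cross term `6 * 𝔼 n² * v` is exactly the one in `3 * (𝔼 n² + v) ^ 2`.
      nlinarith [sq_nonneg (𝔼 r, n r ^ 2)]

/-- Paley–Zygmund inequality for the uniform measure on a finite set, with explicit constants. -/
theorem card_le_four_mul_card_of_moments {Ω : Type*} [Fintype Ω] (Z : Ω → ℝ)
    {V : ℝ} (hV : 0 < V) (h1 : ∑ ω, Z ω = Fintype.card Ω * V)
    (h2 : ∑ ω, Z ω ^ 2 ≤ Fintype.card Ω * (3.24 * V ^ 2)) :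
    Fintype.card Ω ≤ 4 * (Finset.univ.filter fun ω => V / 10 ≤ Z ω).card := by
  classical
  set G := Finset.univ.filter fun ω => V / 10 ≤ Z ω with hG
  set n : ℝ := (Fintype.card Ω : ℝ)
  rcases (Nat.cast_nonneg (Fintype.card Ω) : (0 : ℝ) ≤ _).eq_or_lt with h0 | hn
  · have : Fintype.card Ω = 0 := by exact_mod_cast h0.symm
    omega
  have hsplit := Finset.sum_filter_add_sum_filter_not Finset.univ (fun ω => V / 10 ≤ Z ω) Z
  have hsmall : ∑ ω with ¬ V / 10 ≤ Z ω, Z ω ≤ n * (V / 10) := by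
    calc _ ≤ ∑ ω with ¬ V / 10 ≤ Z ω, V / 10 := Finset.sum_le_sum fun ω h => by
            have := (Finset.mem_filter.1 h).2
            linarith
      _ ≤ ∑ ω : Ω, V / 10 := Finset.sum_le_sum_of_subset_of_nonneg (Finset.filter_subset _ _)
            fun _ _ _ => by positivity
      _ = _ := by simp [n]
  have hbig : n * (0.9 * V) ≤ ∑ ω ∈ G, Z ω := by
    rw [h1] at hsplit
    linarith
  have hcs : (∑ ω ∈ G, Z ω) ^ 2 ≤ G.card * ∑ ω ∈ G, Z ω ^ 2 := sq_sum_le_card_mul_sum_sq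
  have hle : ∑ ω ∈ G, Z ω ^ 2 ≤ ∑ ω, Z ω ^ 2 :=
    Finset.sum_le_sum_of_subset_of_nonneg (Finset.filter_subset _ _) fun _ _ _ => sq_nonneg _
  have h3 : (n * (0.9 * V)) ^ 2 ≤ G.card * (n * (3.24 * V ^ 2)) :=
    (pow_le_pow_left₀ (by positivity) hbig 2).trans (hcs.trans
      (mul_le_mul_of_nonneg_left (hle.trans h2) (Nat.cast_nonneg _)))
  -- The constant 3.24 is `4 * 0.9 ^ 2`, which yields probability exactly 1/4.
  have h4 : (n * V ^ 2 * 0.81) * n ≤ (n * V ^ 2 * 0.81) * (4 * G.card) := by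
    calc _ = (n * (0.9 * V)) ^ 2 := by ring
      _ ≤ _ := h3
      _ = _ := by ring
  have h5 : n ≤ 4 * G.card := le_of_mul_le_mul_left h4 (by positivity)
  simp only [n] at h5
  exact_mod_cast h5

/-! ### Order statistics and coordinate projections -/

theorem le_kthLargest {ι : Type*} (J : Finset ι) (a : ι → ℝ) (t : ℝ) (n : ℕ) (hn : 0 < n)
    (h : n ≤ (J.filter fun i => t ≤ a i).card) : t ≤ kthLargest n J a := by
  classical
  unfold kthLargest
  set L := (J.val.map a).sort (· ≥ ·) with hL
  have hsort : L.Pairwise (· ≥ ·) := Multiset.pairwise_sort _ _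
  have hcount : n ≤ L.countP (fun x => decide (t ≤ x)) := by
    have : (L : Multiset ℝ) = J.val.map a := Multiset.sort_eq _ _
    rw [← Multiset.coe_countP, this, Multiset.countP_map]
    exact h
  have hlen : n - 1 < L.length := by
    have := List.countP_le_length (p := fun x => decide (t ≤ x)) (l := L)
    omega
  rw [List.getD_eq_getElem _ _ hlen]
  by_contra hlt
  push Not at hlt
  have hdrop : (L.drop (n - 1)).countP (fun x => decide (t ≤ x)) = 0 := by
    rw [List.countP_eq_zero]
    intro x hx
    obtain ⟨i, hi, rfl⟩ := List.getElem_of_mem hx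
    rw [List.getElem_drop]
    simp only [decide_eq_true_eq, not_le]
    rcases Nat.eq_zero_or_pos i with rfl | hpos
    · simpa using hlt
    · exact lt_of_le_of_lt (List.pairwise_iff_getElem.1 hsort _ _ _ _ (by omega)) hlt
  have := List.countP_append (p := fun x => decide (t ≤ x)) (l₁ := L.take (n - 1))
    (l₂ := L.drop (n - 1))
  rw [List.take_append_drop, hdrop] at this
  have := List.countP_le_length (p := fun x => decide (t ≤ x)) (l := L.take (n - 1))
  rw [List.length_take] at this
  omega

theorem kthLargest_nonneg {ι : Type*} (n : ℕ) (J : Finset ι) (a : ι → ℝ) (ha : ∀ i, 0 ≤ a i) :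
    0 ≤ kthLargest n J a := by
  unfold kthLargest
  set L := (J.val.map a).sort (· ≥ ·) with hL
  rcases lt_or_ge (n - 1) L.length with h | h
  · rw [List.getD_eq_getElem _ _ h]
    have : L[n - 1] ∈ J.val.map a := (Multiset.mem_sort (r := (· ≥ ·))).1 (List.getElem_mem h)
    obtain ⟨i, -, hi⟩ := Multiset.mem_map.1 this
    exact hi ▸ ha i
  · rw [List.getD_eq_default _ _ h]

theorem exists_coordinateProjection {ι : Type*} [Fintype ι] [DecidableEq ι] (S : Finset ι) :
    ∃ P : EuclideanSpace ℝ ι →ₗ[ℝ] EuclideanSpace ℝ ι, IsCoordinateProjection P ∧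
      Module.finrank ℝ (LinearMap.range P) ≤ S.card ∧
      ∀ x j, P x j = if j ∈ S then x j else 0 := by
  let π : EuclideanSpace ℝ ι →ₗ[ℝ] (S → ℝ) :=
    { toFun := fun x j => x j
      map_add' := fun _ _ => rfl
      map_smul' := fun _ _ => rfl }
  let ι' : (S → ℝ) →ₗ[ℝ] EuclideanSpace ℝ ι :=
    { toFun := fun x => WithLp.toLp 2 fun j => if h : j ∈ S then x ⟨j, h⟩ else 0
      map_add' := fun x y => by ext j; by_cases h : j ∈ S <;> simp [h]
      map_smul' := fun c x => by ext j; by_cases h : j ∈ S <;> simp [h] }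
  have hP : ∀ x j, (ι' ∘ₗ π) x j = if j ∈ S then x j else 0 := by
    intro x j
    by_cases h : j ∈ S
    · simp [ι', π, h]
      rfl
    · simp [ι', h]
  refine ⟨ι' ∘ₗ π, ⟨(S : Set ι), fun x => ⟨fun j hj => ?_, fun j hj => ?_⟩⟩, ?_, hP⟩
  · rw [hP, if_pos (by simpa using hj)]
  · rw [hP, if_neg (by simpa using hj)]
  · calc _ ≤ Module.finrank ℝ (LinearMap.range ι') :=
          Submodule.finrank_mono (LinearMap.range_comp_le_range _ _)
      _ ≤ Module.finrank ℝ (S → ℝ) := LinearMap.finrank_range_le _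
      _ = S.card := by simp

/-! ### The random selection of coordinates -/

/-- The sum of two shifted fourth moments is at most `2 * 3.24` times the square of the averaged
second moment `V`, when the size `h` of the summands is small against `√V`. -/
theorem fourth_moment_bound {a b v h V : ℝ} (hv : 0 ≤ v)
    (hV : V = (a ^ 2 + b ^ 2) / 2 + v) (hh : (100 * h) ^ 2 ≤ V) :
    (a ^ 4 + 6 * a ^ 2 * v + 8 * |a| * h * v + (3 * v ^ 2 + 4 * h ^ 2 * v)) +
      (b ^ 4 + 6 * b ^ 2 * v + 8 * |b| * h * v + (3 * v ^ 2 + 4 * h ^ 2 * v)) ≤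
        2 * (3.24 * V ^ 2) := by
  have hvV : v ≤ V := by rw [hV]; nlinarith [sq_nonneg a, sq_nonneg b]
  have hV0 : 0 ≤ V := hv.trans hvV
  have t0 : (|a| + |b|) * (100 * h) ≤ 3 * V := by
    nlinarith [sq_nonneg (|a| - 100 * h), sq_nonneg (|b| - 100 * h), sq_abs a, sq_abs b]
  have t1 : (|a| + |b|) * (100 * h) * v ≤ 3 * V * V := by gcongr
  have t2 : (100 * h) ^ 2 * v ≤ V * V := by gcongr
  -- The main terms keep the Gaussian constant 3 despite the coin flip, since `a⁴ + b⁴ ≤ (3/2) * (a²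
  -- + b²)²`; the terms in `h` fit in the remaining 0.24.
  have t4 : a ^ 4 + b ^ 4 + 6 * (a ^ 2 + b ^ 2) * v + 6 * v ^ 2 ≤ 6 * V ^ 2 := by
    rw [hV]
    nlinarith [sq_nonneg (a * b), sq_nonneg (a ^ 2 - b ^ 2), sq_nonneg (a ^ 2),
      sq_nonneg (b ^ 2)]
  nlinarith

open scoped BigOperators in
/-- A random choice of one term from each family `w i`, to which `α` is added with probability
one half, is comparable to `(α + ∑ i, ∑ r, w i r) / N` with probability at least one quarter,
where `N` is the size of the families. -/
theorem card_le_four_mul_card_large_choice {κ : Type*} [Fintype κ] [Nonempty κ] (q : ℕ)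
    (w : Fin q → κ → ℝ) (h α b : ℝ) (hw : ∀ i r, |w i r| ≤ h) (hb : 0 < b)
    (hαb : |α + ∑ i, ∑ r, w i r| = b)
    (hh : 100 * h ≤ b / (2 * Fintype.card κ)) (h0 : 0 ≤ h) :
    Fintype.card (Bool × (Fin q → κ)) ≤ 4 * (Finset.univ.filter fun ω : Bool × (Fin q → κ) =>
      (b / (2 * Fintype.card κ)) ^ 2 / 10 ≤
        ((if ω.1 then α else 0) + ∑ i, w i (ω.2 i)) ^ 2).card := by
  classical
  set N : ℝ := (Fintype.card κ : ℝ) with hN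
  have hN1 : 1 ≤ N := by
    have := Fintype.card_pos (α := κ)
    rw [hN]
    exact_mod_cast this
  set μ : Fin q → ℝ := fun i => 𝔼 r, w i r with hμ
  have hμh : ∀ i, |μ i| ≤ h := fun i => (Finset.abs_expect_le _ _).trans
    ((Finset.expect_le_expect fun r _ => hw i r).trans (by simp))
  obtain ⟨v, hv, m1, m2, m3, m4⟩ := moments_sum_centred (2 * h) q (fun i r => w i r - μ i)
    (fun i => by simp [Finset.expect_sub_distrib, hμ])
    (fun i r => (abs_sub _ _).trans (by linarith [hw i r, hμh i]))
  set S : (Fin q → κ) → ℝ := fun g => ∑ i, (w i (g i) - μ i) with hS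
  have m1' : (𝔼 g, S g) = 0 := m1
  have m2' : (𝔼 g, S g ^ 2) = v := m2
  have m3' : |𝔼 g, S g ^ 3| ≤ 2 * h * v := m3
  have m4' : (𝔼 g, S g ^ 4) ≤ 3 * v ^ 2 + (2 * h) ^ 2 * v := m4
  set f : Bool → ℝ := fun s => (if s then α else 0) + ∑ i, μ i with hf
  have hX : ∀ s g, (if s then α else 0) + ∑ i, w i (g i) = f s + S g := by
    intro s g
    simp only [hf, hS, Finset.sum_sub_distrib]
    ring
  have hsum : f true + (N - 1) * f false = α + ∑ i, ∑ r, w i r := by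
    have : ∀ i, ∑ r, w i r = N * μ i := by
      intro i
      rw [hμ, hN, ← nsmul_eq_mul, Fintype.card_smul_expect]
    simp only [this, ← Finset.mul_sum, hf]
    simp
    ring
  -- Cauchy–Schwarz with weights `1` and `N - 1`, using `1 + (N - 1)² ≤ N²`.
  have hF : (b / N) ^ 2 ≤ f true ^ 2 + f false ^ 2 := by
    rw [div_pow, div_le_iff₀ (by positivity), ← hαb, sq_abs, ← hsum]
    nlinarith [sq_nonneg ((N - 1) * f true - f false),
      mul_nonneg (by linarith : 0 ≤ 2 * N - 2) (add_nonneg (sq_nonneg (f true)) (sq_nonneg (f false)))]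
  set V : ℝ := (f true ^ 2 + f false ^ 2) / 2 + v with hV
  have hVb : (b / (2 * N)) ^ 2 ≤ V := by
    have : (b / (2 * N)) ^ 2 = (b / N) ^ 2 / 4 := by field_simp; norm_num
    rw [this]
    nlinarith [sq_nonneg (b / N)]
  have hVpos : 0 < V := lt_of_lt_of_le (by positivity) hVb
  have e2 : ∀ s, (𝔼 g, (f s + S g) ^ 2) = f s ^ 2 + v := by
    intro s
    simp only [add_sq, Finset.expect_add_distrib, ← Finset.mul_expect, m1', m2',
      Fintype.expect_const]
    ring
  have e4 : ∀ s, (𝔼 g, (f s + S g) ^ 4) ≤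
      f s ^ 4 + 6 * f s ^ 2 * v + 8 * |f s| * h * v + (3 * v ^ 2 + 4 * h ^ 2 * v) := by
    intro s
    have e : ∀ a b : ℝ, (a + b) ^ 4 =
        a ^ 4 + 4 * a ^ 3 * b + 6 * a ^ 2 * b ^ 2 + 4 * a * b ^ 3 + b ^ 4 := by
      intros; ring
    simp only [e, Finset.expect_add_distrib, ← Finset.mul_expect, m1', m2', Fintype.expect_const]
    have : f s * (𝔼 g, S g ^ 3) ≤ |f s| * (2 * h * v) :=
      (le_abs_self _).trans (by rw [abs_mul]; gcongr)
    nlinarith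
  set n : ℝ := (Fintype.card (Fin q → κ) : ℝ) with hn
  have hsumE : ∀ φ : Bool × (Fin q → κ) → ℝ, ∑ ω, φ ω =
      n * ((𝔼 g, φ (true, g)) + 𝔼 g, φ (false, g)) := by
    intro φ
    rw [Fintype.sum_prod_type, Fintype.sum_bool, mul_add, hn, ← nsmul_eq_mul, ← nsmul_eq_mul,
      Fintype.card_smul_expect, Fintype.card_smul_expect]
  have hcard : (Fintype.card (Bool × (Fin q → κ)) : ℝ) = 2 * n := by
    rw [Fintype.card_prod, Fintype.card_bool, hn]
    push_cast
    ring
  have hfinal := card_le_four_mul_card_of_moments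
    (fun ω : Bool × (Fin q → κ) => (f ω.1 + S ω.2) ^ 2) hVpos
    (by
      rw [hsumE, hcard]
      simp only [e2]
      rw [hV]
      ring)
    (by
      rw [hsumE, hcard]
      simp only [← pow_mul, Nat.reduceMul]
      rw [mul_comm 2 n, mul_assoc]
      refine mul_le_mul_of_nonneg_left ?_ (Nat.cast_nonneg _)
      refine (add_le_add (e4 true) (e4 false)).trans ?_
      exact fourth_moment_bound hv hV ((pow_le_pow_left₀ (by positivity) hh 2).trans hVb))
  refine hfinal.trans (Nat.mul_le_mul_left 4 (Finset.card_le_card ?_))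
  intro ω hω
  simp only [Finset.mem_filter, Finset.mem_univ, true_and] at hω ⊢
  rw [hX]
  linarith [hω, hVb]

/-- Double counting of the pairs `(l, ω)` with `R l ω`: some `ω` does at least as well as the
average. -/
theorem exists_card_le_four_mul_card {Ω : Type*} [Fintype Ω] [Nonempty Ω] {m : ℕ}
    (R : Fin m → Ω → Prop) [∀ l ω, Decidable (R l ω)]
    (h : ∀ l, Fintype.card Ω ≤ 4 * (Finset.univ.filter fun ω => R l ω).card) :
    ∃ ω, m ≤ 4 * (Finset.univ.filter fun l => R l ω).card := by
  by_contra! hlt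
  have hcomm : ∑ l, (Finset.univ.filter fun ω => R l ω).card =
      ∑ ω, (Finset.univ.filter fun l => R l ω).card := by
    simp only [Finset.card_filter]
    exact Finset.sum_comm
  have h1 : m * Fintype.card Ω ≤ 4 * ∑ l, (Finset.univ.filter fun ω => R l ω).card := by
    rw [Finset.mul_sum]
    refine le_trans (by simp) (Finset.sum_le_sum fun l _ => h l)
  have h2 : 4 * ∑ ω, (Finset.univ.filter fun l => R l ω).card < Fintype.card Ω * m := by
    rw [Finset.mul_sum]
    refine lt_of_lt_of_le (Finset.sum_lt_sum_of_nonempty Finset.univ_nonempty fun ω _ => hlt ω)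
      (by simp)
  rw [hcomm, mul_comm m] at h1
  omega

theorem card_filter_lt_abs_le {k : ℕ} (y : Fin k → ℝ) (hy : ∑ j, y j ^ 2 = 1) {s : ℝ}
    (hs : 0 < s) : ((Finset.univ.filter fun j => s < |y j|).card : ℝ) * s ^ 2 ≤ 1 := by
  calc _ = ∑ j with s < |y j|, s ^ 2 := by simp
    _ ≤ ∑ j with s < |y j|, y j ^ 2 := Finset.sum_le_sum fun j hj => by
        rw [← sq_abs (y j)]
        exact pow_le_pow_left₀ hs.le (Finset.mem_filter.1 hj).2.le 2
    _ ≤ ∑ j, y j ^ 2 := Finset.sum_le_sum_of_subset_of_nonneg (Finset.filter_subset _ _)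
        fun _ _ _ => sq_nonneg _
    _ = 1 := hy

/-- Given a set `A` of coordinates containing all those at which some row is large, there is
a set of at most `|A| + q` coordinates over which at least a quarter of the rows have a large sum. -/
theorem exists_finset_large_sums {k m q N : ℕ} (hN : 0 < N) (hk : k ≤ q * N)
    (z : Fin m → Fin k → ℝ) (A : Finset (Fin k)) {h b : ℝ} (h0 : 0 ≤ h) (hb : 0 < b)
    (hz : ∀ l, ∀ j ∉ A, |z l j| ≤ h) (hbz : ∀ l, b ≤ |∑ j, z l j|)
    (hh : 100 * h ≤ b / (2 * N)) :
    ∃ S : Finset (Fin k), S.card ≤ A.card + q ∧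
      m ≤ 4 * (Finset.univ.filter fun l => (b / (2 * N)) ^ 2 / 10 ≤ (∑ j ∈ S, z l j) ^ 2).card := by
  classical
  have : Nonempty (Fin N) := ⟨⟨0, hN⟩⟩
  obtain ⟨e⟩ : Nonempty (Fin k ↪ Fin q × Fin N) :=
    Function.Embedding.nonempty_of_card_le (by simpa using hk)
  let R : (Fin q → Fin N) → Finset (Fin k) := fun g => Aᶜ.filter fun j => g (e j).1 = (e j).2
  let S : Bool × (Fin q → Fin N) → Finset (Fin k) := fun ω => (if ω.1 then A else ∅) ∪ R ω.2
  -- Each sum has at most one term; slots that are empty or hold an element of `A` contribute 0.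
  let w : Fin m → Fin q → Fin N → ℝ := fun l i r => ∑ j ∈ Aᶜ with e j = (i, r), z l j
  have hRcard : ∀ g, (R g).card ≤ q := by
    intro g
    have := Finset.card_le_card_of_injOn (s := R g) (t := Finset.univ) (fun j => (e j).1)
      (fun _ _ => by simp) (by
        intro j hj j' hj' hjj
        have h1 := (Finset.mem_filter.1 (Finset.mem_coe.1 hj)).2
        have h2 := (Finset.mem_filter.1 (Finset.mem_coe.1 hj')).2
        have h3 : (e j).1 = (e j').1 := hjj
        exact e.injective (Prod.ext h3 (by rw [← h1, ← h2, h3])))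
    simpa using this
  have hScard : ∀ ω, (S ω).card ≤ A.card + q := by
    intro ω
    refine (Finset.card_union_le _ _).trans (Nat.add_le_add ?_ (hRcard _))
    split_ifs <;> simp
  have hRsum : ∀ l g, ∑ j ∈ R g, z l j = ∑ i, w l i (g i) := by
    intro l g
    rw [← Finset.sum_fiberwise (R g) (fun j => (e j).1)]
    refine Finset.sum_congr rfl fun i _ => Finset.sum_congr ?_ fun _ _ => rfl
    ext j
    simp only [R, Finset.mem_filter, and_assoc, Prod.ext_iff]
    refine and_congr_right fun _ => ⟨?_, ?_⟩
    · rintro ⟨h1, rfl⟩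
      exact ⟨rfl, h1.symm⟩
    · rintro ⟨rfl, h1⟩
      exact ⟨h1.symm, rfl⟩
  have hSsum : ∀ l ω, ∑ j ∈ S ω, z l j =
      (if ω.1 then ∑ j ∈ A, z l j else 0) + ∑ i, w l i (ω.2 i) := by
    intro l ω
    rw [← hRsum, Finset.sum_union]
    · split_ifs <;> simp
    · have : Disjoint A (R ω.2) := Finset.disjoint_left.2 fun j hj hj' =>
        (Finset.mem_compl.1 (Finset.mem_filter.1 hj').1) hj
      split_ifs
      · exact this
      · simp
  have htotal : ∀ l, (∑ j ∈ A, z l j) + ∑ i, ∑ r, w l i r = ∑ j, z l j := by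
    intro l
    rw [← Finset.sum_add_sum_compl A, ← Finset.sum_fiberwise Aᶜ e, Fintype.sum_prod_type]
  have hwh : ∀ l i r, |w l i r| ≤ h := by
    intro l i r
    have hcard : (Aᶜ.filter fun j => e j = (i, r)).card ≤ 1 := Finset.card_le_one.2 fun j hj j' hj' =>
      e.injective ((Finset.mem_filter.1 hj).2.trans (Finset.mem_filter.1 hj').2.symm)
    calc |w l i r| ≤ ∑ j ∈ Aᶜ with e j = (i, r), |z l j| := Finset.abs_sum_le_sum_abs _ _
      _ ≤ (Aᶜ.filter fun j => e j = (i, r)).card • h := Finset.sum_le_card_nsmul _ _ _ fun j hj =>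
          hz l j (Finset.mem_compl.1 (Finset.mem_filter.1 hj).1)
      _ ≤ 1 • h := nsmul_le_nsmul_left h0 hcard
      _ = h := one_nsmul h
  have hN' : (0 : ℝ) < N := by exact_mod_cast hN
  obtain ⟨ω, hω⟩ := exists_card_le_four_mul_card
    (fun l ω => (b / (2 * N)) ^ 2 / 10 ≤ (∑ j ∈ S ω, z l j) ^ 2) (fun l => by
      have hbl : b / (2 * N) ≤ |∑ j, z l j| / (2 * N) := by gcongr; exact hbz l
      refine (card_le_four_mul_card_large_choice q (w l) h (∑ j ∈ A, z l j) |∑ j, z l j| (hwh l)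
        (hb.trans_le (hbz l)) (by rw [htotal]) (by rw [Fintype.card_fin]; exact hh.trans hbl)
        h0).trans (Nat.mul_le_mul_left 4 (Finset.card_le_card ?_))
      intro ω hω
      simp only [Finset.mem_filter, Finset.mem_univ, true_and, Fintype.card_fin] at hω ⊢
      rw [hSsum]
      refine le_trans ?_ hω
      gcongr)
  exact ⟨S ω, hScard ω, hω⟩

/-! ### Choice of parameters -/

theorem lemmal :
    ∃ C : ℝ, 0 < C ∧
      ∀ (δ : ℝ) (k m : ℕ), 0 < δ → δ ≤ 1 → 12 / δ ^ 2 ≤ (k : ℝ) → 4 ≤ m →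
        ∀ (T : Matrix (Fin m) (Fin k) ℝ) (y : EuclideanSpace ℝ (Fin k)),
          y ∈ Metric.sphere (0 : EuclideanSpace ℝ (Fin k)) 1 →
          ∃ P : EuclideanSpace ℝ (Fin k) →ₗ[ℝ] EuclideanSpace ℝ (Fin k),
            IsCoordinateProjection P ∧
            (Module.finrank ℝ (LinearMap.range P) : ℝ) ≤ δ * (k : ℝ) ∧
            C⁻¹ * δ ^ 2 * (⨅ l : Fin m, |(T *ᵥ y.ofLp) l|) ≤
              (⨆ p : Fin m × Fin k, |T p.1 p.2|) / √(k : ℝ) +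
                kthLargest (m / 4) Finset.univ (fun l : Fin m => |(T *ᵥ (P y).ofLp) l|) := by

  classical
  refine ⟨2000, by norm_num, ?_⟩
  intro δ k m hδ hδ1 hk hm T y hy
  set M := ⨆ p : Fin m × Fin k, |T p.1 p.2| with hM
  set b := ⨅ l : Fin m, |(T *ᵥ y.ofLp) l| with hb
  have hMle : ∀ l j, |T l j| ≤ M := fun l j =>
    le_ciSup (f := fun p : Fin m × Fin k => |T p.1 p.2|) (Set.finite_range _).bddAbove (l, j)
  have hM0 : 0 ≤ M := Real.iSup_nonneg fun _ => abs_nonneg _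
  have hble : ∀ l, b ≤ |(T *ᵥ y.ofLp) l| := fun l => ciInf_le (Set.finite_range _).bddBelow l
  have hk12 : 12 ≤ δ ^ 2 * (k : ℝ) := by
    rwa [div_le_iff₀' (by positivity)] at hk
  have hk0 : (0 : ℝ) < k := by
    by_contra hcon
    have : (k : ℝ) = 0 := le_antisymm (not_lt.1 hcon) (Nat.cast_nonneg _)
    rw [this] at hk12
    linarith
  have hsk : 0 < √(k : ℝ) := Real.sqrt_pos.2 hk0
  set u := M / √(k : ℝ) with hu
  have hu0 : 0 ≤ u := by positivity
  by_cases htriv : 2000⁻¹ * δ ^ 2 * b ≤ u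
  · obtain ⟨P, hP, hrank, -⟩ := exists_coordinateProjection (∅ : Finset (Fin k))
    refine ⟨P, hP, ?_, htriv.trans (le_add_of_nonneg_right
      (kthLargest_nonneg _ _ _ fun _ => abs_nonneg _))⟩
    have : Module.finrank ℝ (LinearMap.range P) = 0 := by simpa using hrank
    rw [this]
    push_cast
    positivity
  push Not at htriv
  have hb0 : 0 < b := by
    by_contra hcon
    have : 2000⁻¹ * δ ^ 2 * b ≤ 0 := mul_nonpos_of_nonneg_of_nonpos (by positivity) (not_lt.1 hcon)
    linarith
  -- Chebyshev then gives `|A| ≤ δ²k/4`, while `M * s = 2u/δ` is at most `δb/1000` by `htriv`; this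
  -- smallness is what dictates 2000.
  set s : ℝ := 2 / (δ * √(k : ℝ)) with hs
  have hs0 : 0 < s := by positivity
  set A : Finset (Fin k) := Finset.univ.filter fun j => s < |y j| with hA
  have hy1 : ∑ j, y j ^ 2 = 1 := by
    have h1 : ‖y‖ = 1 := by simpa using hy
    have h2 := EuclideanSpace.norm_sq_eq y
    rw [h1] at h2
    simpa using h2.symm
  have hAcard : (A.card : ℝ) ≤ δ * k / 4 := by
    have h1 := card_filter_lt_abs_le y.ofLp hy1 hs0
    have h2 : s ^ 2 = 4 / (δ ^ 2 * k) := by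
      rw [hs, div_pow, mul_pow, Real.sq_sqrt hk0.le]
      norm_num
    rw [h2, mul_div_assoc', div_le_one (by positivity)] at h1
    have h3 : δ ^ 2 * k ≤ δ * k := by
      gcongr
      nlinarith
    linarith
  set N : ℕ := ⌈3 / δ⌉₊ with hN
  have hN3 : 3 / δ ≤ N := Nat.le_ceil _
  have hNpos : 0 < N := Nat.ceil_pos.2 (by positivity)
  have hNpos' : (0 : ℝ) < N := by exact_mod_cast hNpos
  have hN4 : δ * N ≤ 4 := by
    have h1 : (N : ℝ) < 3 / δ + 1 := Nat.ceil_lt_add_one (by positivity)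
    have h2 : δ * N ≤ δ * (3 / δ + 1) := by gcongr
    have h3 : δ * (3 / δ + 1) = 3 + δ := by field_simp
    linarith
  have hbN : δ * b / 8 ≤ b / (2 * N) := by
    rw [le_div_iff₀ (by positivity)]
    nlinarith
  obtain ⟨S, hScard, hS⟩ := exists_finset_large_sums (q := k / N + 1) hNpos
    (by
      have := Nat.div_add_mod k N
      have := Nat.mod_lt k hNpos
      nlinarith)
    (fun l j => T l j * y j) A (h := M * s) (b := b) (by positivity) hb0
    (fun l j hj => by
      have : |y j| ≤ s := by simpa [hA] using hj
      rw [abs_mul]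
      gcongr
      exact hMle l j)
    (fun l => hble l)
    (by
      have h1 : M * s = 2 * u / δ := by
        rw [hs, hu]
        field_simp
      have h2 : 2 * u / δ ≤ δ * b / 1000 := by
        rw [div_le_iff₀ hδ]
        nlinarith
      rw [h1]
      have : 0 < δ * b := by positivity
      linarith)
  obtain ⟨P, hP, hrank, hPS⟩ := exists_coordinateProjection S
  refine ⟨P, hP, ?_, ?_⟩
  · have h1 : (Module.finrank ℝ (LinearMap.range P) : ℝ) ≤ A.card + ((k / N : ℕ) + 1) := by
      exact_mod_cast hrank.trans hScard
    have h2 : ((k / N : ℕ) : ℝ) ≤ δ * k / 3 := by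
      refine Nat.cast_div_le.trans ?_
      rw [div_le_iff₀ hNpos']
      rw [div_le_iff₀' hδ] at hN3
      nlinarith
    have h3 : 12 ≤ δ * k := by nlinarith
    linarith
  · refine le_add_of_nonneg_of_le hu0 (le_kthLargest _ _ _ _ (by omega) ?_)
    have hcard : (Finset.univ.filter fun l : Fin m =>
        (b / (2 * N)) ^ 2 / 10 ≤ (∑ j ∈ S, T l j * y j) ^ 2).card ≤
        (Finset.univ.filter fun l : Fin m =>
          2000⁻¹ * δ ^ 2 * b ≤ |(T *ᵥ (P y).ofLp) l|).card := by
      refine Finset.card_le_card fun l hl => ?_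
      simp only [Finset.mem_filter, Finset.mem_univ, true_and] at hl ⊢
      have h1 : (T *ᵥ (P y).ofLp) l = ∑ j ∈ S, T l j * y j := by
        simp [Matrix.mulVec, dotProduct, hPS, Finset.sum_ite_mem]
      rw [h1]
      rw [← sq_abs (∑ j ∈ S, T l j * y j)] at hl
      refine (pow_le_pow_iff_left₀ (by positivity) (abs_nonneg _) two_ne_zero).1 (le_trans ?_ hl)
      have h2 : (δ * b / 8) ^ 2 ≤ (b / (2 * N)) ^ 2 := by gcongr
      have h3 : (2000⁻¹ * δ ^ 2 * b) ^ 2 ≤ (2000⁻¹ * δ * b) ^ 2 := by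
        gcongr
        nlinarith
      nlinarith [sq_nonneg (δ * b)]
    omega
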